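/- Let $n\ge 2$, $n<p<\infty$. For an open set $O\subseteq\mathbb R^n$ let $AC(O)$ be the class of all nonempty open sets with smooth boundary and with compact closure contained in $O$. Let $\Omega\in AC(\mathbb R^n)$, let $V$ denote Lebesgue measure, let $C_0^\infty(\Omega)$ be the real-valued smooth functions with compact support in $\Omega$, and let $W^{1,p}_0(\Omega)$ be the closure of $C_0^\infty(\Omega)$ under the norm $\|f\|_{L^p(\Omega)}+\|\nabla f\|_{L^p(\Omega)}$. Put $$\lambda_p(\Omega)=\inf\Big\{\frac{\int_\Omega|\nabla f|^p\,dV}{\int_\Omega|f|^p\,dV}:\ 0\ne f\in W^{1,p}_0(\Omega)\Big\},$$ $$\operatorname{cap}_p(K;\Omega)=\inf\Big\{\int_\Omega|\nabla f|^p\,dV:\ f\in C_0^\infty(\Omega),\ f\ge 1\text{ on }K\Big\}\quad (K\subset\Omega\text{ compact}),$$ $$E_{n,p}(\Omega)=\inf\Big\{V(\Omega)^{\frac{p-n}{n}}\int_\Omega|\nabla f|^p\,dV:\ f\in C_0^\infty(\Omega),\ \|f\|_{L^\infty(\Omega)}=1\Big\}.$$ For a real number $\kappa$ consider the following statements. (i)$_\kappa$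 (the $p$-Faber–Krahn inequality) $\ \lambda_p(\Omega)\,V(\Omega)^{\frac pn}\ge\kappa$. (ii)$_\kappa$ (the capacity–volume inequality) $\ \operatorname{cap}_p(\bar\Sigma;\Omega)\,V(\Omega)^{\frac{p-n}{n}}\ge\kappa$ for all $\Sigma\in AC(\Omega)$. (iii)$_\kappa$ (the $(p,\infty)$-Sobolev inequality) $\ \big(\int_\Omega|\nabla f|^p\,dV\big)\,\|f\|_{L^\infty(\Omega)}^{-p}\,V(\Omega)^{\frac{p-n}{n}}\ge\kappa$ for all $f\in C_0^\infty(\Omega)$ with $f\not\equiv 0$. For $\kappa=E_{n,p}(\Omega)$ the statements (ii)$_\kappa$ and (iii)$_\kappa$ are equivalent, and each of them implies (i)$_\kappa$. The same equivalence and implications hold for every real constant $\kappa$. -/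

import Mathlib

open MeasureTheory Filter Topology TopologicalSpace
open scoped ENNReal ContDiff Distributions Gradient

/-- The Euclidean space `ℝⁿ`. -/
abbrev Euc (n : ℕ) : Type := EuclideanSpace ℝ (Fin n)

/-- The set `S` has smooth boundary: near each boundary point `x` it is the strict sublevel set
`{ρ < 0}` of a smooth function `ρ` whose differential does not vanish at `x`. -/
def HasSmoothBoundary {n : ℕ} (S : Set (Euc n)) : Prop :=
  ∀ x ∈ frontier S, ∃ U ∈ 𝓝 x, ∃ ρ : Euc n → ℝ,
    ContDiff ℝ ∞ ρ ∧ fderiv ℝ ρ x ≠ 0 ∧ ∀ y ∈ U, (y ∈ S ↔ ρ y < 0)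

/-- The admissible class `AC(O)` of an open set `O ⊆ ℝⁿ`: the nonempty open sets with smooth
boundary whose closure is compact and contained in `O`. -/
def AC {n : ℕ} (O : Opens (Euc n)) : Set (Opens (Euc n)) :=
  {S | (S : Set (Euc n)).Nonempty ∧ IsCompact (closure (S : Set (Euc n))) ∧
    closure (S : Set (Euc n)) ⊆ O ∧ HasSmoothBoundary (S : Set (Euc n))}

/-- The volume `V(Ω)`. -/
noncomputable def vol {n : ℕ} (Ω : Opens (Euc n)) : ℝ :=
  (volume : Measure (Euc n)).real Ω

/-- The `p`-energy `∫_Ω |∇f|^p dV` of a smooth function with compact support in `Ω`. -/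
noncomputable def pEnergy {n : ℕ} (p : ℝ) (Ω : Opens (Euc n)) (f : 𝓓(Ω, ℝ)) : ℝ :=
  ∫ x in (Ω : Set (Euc n)), ‖∇ (f : Euc n → ℝ) x‖ ^ p

/-- The norm `‖f‖_{L^∞(Ω)}`. -/
noncomputable def linftyNorm {n : ℕ} (Ω : Opens (Euc n)) (f : 𝓓(Ω, ℝ)) : ℝ :=
  (eLpNorm (f : Euc n → ℝ) ∞ (volume.restrict (Ω : Set (Euc n)))).toReal

/-- The `p`-capacity `cap_p(K; Ω)` of a compact set `K ⊆ Ω` relative to `Ω`. -/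
noncomputable def pCap {n : ℕ} (p : ℝ) (K : Set (Euc n)) (Ω : Opens (Euc n)) : ℝ :=
  sInf {c | ∃ f : 𝓓(Ω, ℝ), (∀ x ∈ K, 1 ≤ f x) ∧ c = pEnergy p Ω f}

/-- The vector field `g` is the weak gradient of `u` on `Ω`. -/
def IsWeakGradient {n : ℕ} (Ω : Opens (Euc n)) (u : Euc n → ℝ) (g : Euc n → Euc n) : Prop :=
  ∀ (φ : 𝓓(Ω, ℝ)) (v : Euc n),
    ∫ x in (Ω : Set (Euc n)), u x * fderiv ℝ (φ : Euc n → ℝ) x v =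
      -∫ x in (Ω : Set (Euc n)), inner ℝ (g x) v * φ x

/-- The function `u` belongs to the Sobolev space `W_0^{1,p}(Ω)` and has weak gradient `g`:
`u` and `g` are in `L^p(Ω)`, and `u` is a limit of smooth functions with compact support in `Ω`
for the norm `‖·‖_{L^p(Ω)} + ‖∇·‖_{L^p(Ω)}`. -/
structure MemW0 {n : ℕ} (p : ℝ) (Ω : Opens (Euc n)) (u : Euc n → ℝ) (g : Euc n → Euc n) :
    Prop where
  memLp : MemLp u (ENNReal.ofReal p) (volume.restrict (Ω : Set (Euc n)))
  memLp_grad : MemLp g (ENNReal.ofReal p) (volume.restrict (Ω : Set (Euc n)))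
  weakGradient : IsWeakGradient Ω u g
  approx : ∃ φ : ℕ → 𝓓(Ω, ℝ), Tendsto (fun k =>
    eLpNorm (fun x => φ k x - u x) (ENNReal.ofReal p) (volume.restrict (Ω : Set (Euc n))) +
    eLpNorm (fun x => ∇ (φ k : Euc n → ℝ) x - g x) (ENNReal.ofReal p)
      (volume.restrict (Ω : Set (Euc n)))) atTop (𝓝 0)

/-- The principal `p`-Laplacian eigenvalue `λ_p(Ω)`: the infimum of the quotients
`∫_Ω |∇u|^p dV / ∫_Ω |u|^p dV` over all nonzero `u ∈ W_0^{1,p}(Ω)`. -/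
noncomputable def pEigenvalue {n : ℕ} (p : ℝ) (Ω : Opens (Euc n)) : ℝ :=
  sInf {c | ∃ (u : Euc n → ℝ) (g : Euc n → Euc n), MemW0 p Ω u g ∧
    ¬ u =ᵐ[volume.restrict (Ω : Set (Euc n))] 0 ∧
    c = (∫ x in (Ω : Set (Euc n)), ‖g x‖ ^ p) / ∫ x in (Ω : Set (Euc n)), |u x| ^ p}

/-- The constant `E_{n,p}(Ω)`: the infimum of the normalized `p`-energies
`V(Ω)^{(p-n)/n} ∫_Ω |∇f|^p dV` over the smooth functions `f` with compact support in `Ω` that are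
normalized by `‖f‖_{L^∞(Ω)} = 1`. -/
noncomputable def energyConst {n : ℕ} (p : ℝ) (Ω : Opens (Euc n)) : ℝ :=
  sInf {c | ∃ f : 𝓓(Ω, ℝ), linftyNorm Ω f = 1 ∧
    c = vol Ω ^ ((p - n) / n) * pEnergy p Ω f}

/-- The `p`-Faber-Krahn inequality on `Ω` with constant `κ`. -/
def FaberKrahn {n : ℕ} (p : ℝ) (Ω : Opens (Euc n)) (κ : ℝ) : Prop :=
  pEigenvalue p Ω * vol Ω ^ (p / n) ≥ κ

/-- The `(p, (p-n)/n)`-capacity-volume inequality on `Ω` with constant `κ`. -/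
def CapacityVolume {n : ℕ} (p : ℝ) (Ω : Opens (Euc n)) (κ : ℝ) : Prop :=
  ∀ S ∈ AC Ω, pCap p (closure (S : Set (Euc n))) Ω * vol Ω ^ ((p - n) / n) ≥ κ

/-- The `(p, ∞)`-Sobolev inequality on `Ω` with constant `κ`; the quotient is taken over the
functions `f` that are not identically zero. -/
def SobolevInfty {n : ℕ} (p : ℝ) (Ω : Opens (Euc n)) (κ : ℝ) : Prop :=
  ∀ f : 𝓓(Ω, ℝ), f ≠ 0 →
    pEnergy p Ω f * linftyNorm Ω f ^ (-p) * vol Ω ^ ((p - n) / n) ≥ κ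

/-! ### Test functions: weak gradients, energy, sup norm, cutoffs. -/

section TestFunctions

variable {n : ℕ} {Ω : Opens (Euc n)}

/-! Capacity-volume and Sobolev are one inequality up to scaling. A capacity competitor has sup norm
at least 1, so Sobolev bounds its energy (`SobolevInfty.capacityVolume`). Conversely, let |f| peak
at x and take 0 < t < 1: f / (t f(x)) exceeds 1 on a small closed ball about x, hence competes for
the capacity of that ball, and t → 1 gives Sobolev (`CapacityVolume.sobolevInfty`). For Faber-Krahn,
∫|f|^p ≤ ‖f‖_∞^p V(Ω) turns Sobolev into a bound on test functions, which passes to W_0^{1,p} by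
density (`MemW0.mul_setIntegral_le`). Nothing depends on the value of κ. -/

theorem TestFunction.apply_eq_zero_of_notMem (f : 𝓓(Ω, ℝ)) {x : Euc n} (hx : x ∉ Ω) : f x = 0 :=
  image_eq_zero_of_notMem_tsupport fun h => hx (f.tsupport_subset h)

theorem TestFunction.continuous_gradient (f : 𝓓(Ω, ℝ)) : Continuous (∇ (f : Euc n → ℝ)) :=
  (InnerProductSpace.toDual ℝ (Euc n)).symm.continuous.comp
    (f.contDiff.continuous_fderiv (by simp))

theorem TestFunction.hasCompactSupport_gradient (f : 𝓓(Ω, ℝ)) :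
    HasCompactSupport (∇ (f : Euc n → ℝ)) :=
  (f.hasCompactSupport.fderiv ℝ).comp_left (map_zero _)

theorem TestFunction.memLp (f : 𝓓(Ω, ℝ)) (q : ℝ≥0∞) :
    MemLp f q (volume.restrict (Ω : Set (Euc n))) :=
  (f.continuous.memLp_of_hasCompactSupport f.hasCompactSupport).restrict _

theorem TestFunction.memLp_gradient (f : 𝓓(Ω, ℝ)) (q : ℝ≥0∞) :
    MemLp (∇ (f : Euc n → ℝ)) q (volume.restrict (Ω : Set (Euc n))) :=
  (f.continuous_gradient.memLp_of_hasCompactSupport f.hasCompactSupport_gradient).restrict _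

theorem TestFunction.isWeakGradient_gradient (f : 𝓓(Ω, ℝ)) :
    IsWeakGradient Ω f (∇ (f : Euc n → ℝ)) := by
  intro φ v
  have hcont (g : 𝓓(Ω, ℝ)) : Continuous fun x => fderiv ℝ (g : Euc n → ℝ) x v :=
    (g.contDiff.continuous_fderiv (by simp)).clm_apply continuous_const
  -- Both integrands vanish off Ω, so integration by parts can be done on the whole space.
  rw [setIntegral_eq_integral_of_forall_compl_eq_zero fun x hx => by
      rw [f.apply_eq_zero_of_notMem hx, zero_mul],
    setIntegral_eq_integral_of_forall_compl_eq_zero fun x hx => by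
      rw [φ.apply_eq_zero_of_notMem hx, mul_zero]]
  simp only [inner_gradient_left]
  refine integral_mul_fderiv_eq_neg_fderiv_mul_of_integrable ?_ ?_ ?_ ?_ ?_
  · exact ((hcont f).mul φ.continuous).integrable_of_hasCompactSupport
      φ.hasCompactSupport.mul_left
  · exact (f.continuous.mul (hcont φ)).integrable_of_hasCompactSupport
      f.hasCompactSupport.mul_right
  · exact (f.continuous.mul φ.continuous).integrable_of_hasCompactSupport
      f.hasCompactSupport.mul_right
  · exact fun x _ => f.contDiff.differentiable (by simp) x
  · exact fun x _ => φ.contDiff.differentiable (by simp) x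

theorem TestFunction.memW0 (f : 𝓓(Ω, ℝ)) (p : ℝ) : MemW0 p Ω f (∇ (f : Euc n → ℝ)) where
  memLp := f.memLp _
  memLp_grad := f.memLp_gradient _
  weakGradient := f.isWeakGradient_gradient
  approx := ⟨fun _ => f, by simp⟩

theorem pEnergy_nonneg (p : ℝ) (f : 𝓓(Ω, ℝ)) : 0 ≤ pEnergy p Ω f :=
  integral_nonneg fun _ => by positivity

theorem pEnergy_smul (p c : ℝ) (f : 𝓓(Ω, ℝ)) : pEnergy p Ω (c • f) = |c| ^ p * pEnergy p Ω f := by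
  have hgrad (x : Euc n) : ∇ ((c • f : 𝓓(Ω, ℝ)) : Euc n → ℝ) x = c • ∇ (f : Euc n → ℝ) x := by
    have hcoe : ((c • f : 𝓓(Ω, ℝ)) : Euc n → ℝ) = c • (f : Euc n → ℝ) := rfl
    rw [hcoe, gradient, fderiv_const_smul (f.contDiff.differentiable (by simp) x), map_smulₛₗ]
    simp [gradient]
  simp only [pEnergy, hgrad, norm_smul, Real.norm_eq_abs,
    Real.mul_rpow (abs_nonneg c) (norm_nonneg _), integral_const_mul]

theorem linftyNorm_nonneg (f : 𝓓(Ω, ℝ)) : 0 ≤ linftyNorm Ω f := ENNReal.toReal_nonneg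

/-- By continuity, the points of Ω violating the bound form an open null set, which is empty. -/
theorem abs_apply_le_linftyNorm (f : 𝓓(Ω, ℝ)) (x : Euc n) : |f x| ≤ linftyNorm Ω f := by
  by_contra! h
  have hx : x ∈ Ω := by
    by_contra hx
    rw [f.apply_eq_zero_of_notMem hx, abs_zero] at h
    exact (linftyNorm_nonneg f).not_gt h
  have hae : ∀ᵐ y ∂(volume.restrict (Ω : Set (Euc n))), |f y| ≤ linftyNorm Ω f := by
    filter_upwards [enorm_ae_le_eLpNormEssSup (f : Euc n → ℝ)
      (volume.restrict (Ω : Set (Euc n)))] with y hy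
    have htop := (f.memLp ∞).eLpNorm_ne_top
    rw [← eLpNorm_exponent_top] at hy
    simpa [linftyNorm] using ENNReal.toReal_mono htop hy
  rw [ae_restrict_iff' Ω.isOpen.measurableSet] at hae
  have hopen : IsOpen ((Ω : Set (Euc n)) ∩ {y | linftyNorm Ω f < |f y|}) :=
    Ω.isOpen.inter (isOpen_lt continuous_const f.continuous.abs)
  refine (hopen.measure_pos volume ⟨x, hx, h⟩).ne' ?_
  refine measure_mono_null (t := {y | ¬(y ∈ (Ω : Set (Euc n)) → |f y| ≤ linftyNorm Ω f)}) ?_ hae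
  exact fun y hy hle => (hle hy.1).not_gt hy.2

theorem linftyNorm_le {f : 𝓓(Ω, ℝ)} {C : ℝ} (hC : 0 ≤ C) (h : ∀ x, |f x| ≤ C) :
    linftyNorm Ω f ≤ C := by
  refine ENNReal.toReal_le_of_le_ofReal hC ?_
  rw [eLpNorm_exponent_top]
  exact eLpNormEssSup_le_of_ae_bound (ae_of_all _ h)

theorem linftyNorm_pos {f : 𝓓(Ω, ℝ)} (hf : f ≠ 0) : 0 < linftyNorm Ω f := by
  obtain ⟨x, hx⟩ := DFunLike.ne_iff.1 hf
  exact (abs_pos.2 hx).trans_le (abs_apply_le_linftyNorm f x)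

theorem exists_abs_apply_eq_linftyNorm (f : 𝓓(Ω, ℝ)) : ∃ x, |f x| = linftyNorm Ω f := by
  obtain ⟨x, hx⟩ := f.continuous.abs.exists_forall_ge_of_hasCompactSupport
    (f.hasCompactSupport.comp_left abs_zero)
  exact ⟨x, (abs_apply_le_linftyNorm f x).antisymm (linftyNorm_le (abs_nonneg _) hx)⟩

theorem exists_testFunction_eq_one_on {K : Set (Euc n)} (hK : IsCompact K)
    (hKΩ : K ⊆ Ω) : ∃ f : 𝓓(Ω, ℝ), ∀ x ∈ K, f x = 1 := by
  obtain ⟨L, hL, hKL, hLΩ⟩ := exists_compact_between hK Ω.isOpen hKΩ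
  obtain ⟨f, hf1, hf0, -⟩ := exists_contMDiffMap_one_nhds_of_subset_interior
    (n := (⊤ : ℕ∞)) (modelWithCornersSelf ℝ (Euc n)) hK.isClosed hKL
  have hsupp : tsupport f ⊆ L :=
    closure_minimal (fun x hx => by_contra fun h => hx (hf0 x h)) hL.isClosed
  exact ⟨⟨f, f.contMDiff.contDiff, hL.of_isClosed_subset (isClosed_tsupport _) hsupp,
    hsupp.trans hLΩ⟩, hf1.self_of_nhdsSet⟩

theorem exists_testFunction_not_ae_eq_zero (hΩ : (Ω : Set (Euc n)).Nonempty) :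
    ∃ f : 𝓓(Ω, ℝ), ¬ (f : Euc n → ℝ) =ᵐ[volume.restrict (Ω : Set (Euc n))] 0 := by
  obtain ⟨x, hx⟩ := hΩ
  obtain ⟨f, hf⟩ := exists_testFunction_eq_one_on (isCompact_singleton (x := x))
    (Set.singleton_subset_iff.2 hx)
  refine ⟨f, fun h => ?_⟩
  have := Measure.eqOn_open_of_ae_eq h Ω.isOpen f.continuous.continuousOn
    continuous_zero.continuousOn hx
  simp [hf x rfl] at this

end TestFunctions

/-! ### Balls as admissible sets. -/

section Ball

variable {n : ℕ}

theorem hasSmoothBoundary_ball (x : Euc n) (r : ℝ) (hr : 0 < r) :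
    HasSmoothBoundary (Metric.ball x r) := by
  intro y hy
  rw [frontier_ball x hr.ne', mem_sphere_iff_norm] at hy
  refine ⟨Set.univ, univ_mem, fun z => ‖z - x‖ ^ 2 - r ^ 2, ?_, ?_, fun z _ => ?_⟩
  · exact ((contDiff_id.sub contDiff_const).norm_sq ℝ).sub contDiff_const
  · have hd : HasFDerivAt (fun z => ‖z - x‖ ^ 2 - r ^ 2) (2 • innerSL ℝ (y - x)) y := by
      simpa using ((hasFDerivAt_id y).sub_const x).norm_sq.sub_const (r ^ 2)
    rw [hd.fderiv]
    intro h
    have h2 := DFunLike.congr_fun h (y - x)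
    rw [smul_apply, innerSL_apply_apply, real_inner_self_eq_norm_sq, hy] at h2
    simp [hr.ne'] at h2
  · rw [mem_ball_iff_norm, sub_neg, sq_lt_sq₀ (norm_nonneg _) hr.le]

theorem ball_mem_AC {O : Opens (Euc n)} {x : Euc n} {r : ℝ} (hr : 0 < r)
    (hO : Metric.closedBall x r ⊆ O) :
    (⟨Metric.ball x r, Metric.isOpen_ball⟩ : Opens (Euc n)) ∈ AC O := by
  refine ⟨⟨x, Metric.mem_ball_self hr⟩, ?_, ?_, hasSmoothBoundary_ball x r hr⟩
  · exact (isCompact_closedBall x r).closure_of_subset Metric.ball_subset_closedBall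
  · exact Metric.closure_ball_subset_closedBall.trans hO

end Ball

/-! ### The three inequalities. -/

section Inequalities

variable {n : ℕ} {p κ : ℝ} {Ω : Opens (Euc n)}

theorem volume_lt_top_of_mem_AC {O : Opens (Euc n)} (hΩ : Ω ∈ AC O) :
    volume (Ω : Set (Euc n)) < ⊤ :=
  (measure_mono subset_closure).trans_lt hΩ.2.1.measure_lt_top

theorem vol_pos_of_mem_AC {O : Opens (Euc n)} (hΩ : Ω ∈ AC O) : 0 < vol Ω :=
  ENNReal.toReal_pos (Ω.isOpen.measure_pos volume hΩ.1).ne' (volume_lt_top_of_mem_AC hΩ).ne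

theorem vol_nonneg : 0 ≤ vol Ω := measureReal_nonneg

theorem pCap_le (K : Set (Euc n)) {f : 𝓓(Ω, ℝ)} (hf : ∀ x ∈ K, 1 ≤ f x) :
    pCap p K Ω ≤ pEnergy p Ω f :=
  csInf_le ⟨0, by rintro _ ⟨g, -, rfl⟩; exact pEnergy_nonneg p g⟩ ⟨f, hf, rfl⟩

theorem SobolevInfty.mul_linftyNorm_rpow_le (h : SobolevInfty p Ω κ) {f : 𝓓(Ω, ℝ)} (hf : f ≠ 0) :
    κ * linftyNorm Ω f ^ p ≤ pEnergy p Ω f * vol Ω ^ ((p - n) / n) := by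
  have hM := linftyNorm_pos hf
  have h1 := mul_le_mul_of_nonneg_right (h f hf) (Real.rpow_nonneg hM.le p)
  refine h1.trans_eq ?_
  rw [Real.rpow_neg hM.le]
  have := (Real.rpow_pos_of_pos hM p).ne'
  field_simp

theorem SobolevInfty.capacityVolume (hp : 0 < p) (hΩ : 0 < vol Ω) (h : SobolevInfty p Ω κ) :
    CapacityVolume p Ω κ := by
  intro S hS
  have hW : 0 < vol Ω ^ ((p - n) / n) := Real.rpow_pos_of_pos hΩ _
  rw [ge_iff_le, ← div_le_iff₀ hW]
  obtain ⟨f₁, hf₁⟩ := exists_testFunction_eq_one_on hS.2.1 hS.2.2.1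
  -- A competitor must be exhibited, since `sInf ∅ = 0` in ℝ.
  refine le_csInf ⟨_, f₁, fun x hx => (hf₁ x hx).ge, rfl⟩ ?_
  rintro _ ⟨f, hf, rfl⟩
  rw [div_le_iff₀ hW]
  -- The bound κ ≤ κ‖f‖_∞^p used below needs κ ≥ 0; for κ ≤ 0 nonnegativity of the energy suffices.
  obtain hκ | hκ := le_total κ 0
  · exact hκ.trans (mul_nonneg (pEnergy_nonneg p f) hW.le)
  obtain ⟨x, hx⟩ := hS.1
  have hfx : 1 ≤ f x := hf x (subset_closure hx)
  have hf0 : f ≠ 0 := by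
    rintro rfl
    exact zero_lt_one.not_ge hfx
  refine le_trans ?_ (h.mul_linftyNorm_rpow_le hf0)
  have hM : 1 ≤ linftyNorm Ω f := hfx.trans ((le_abs_self _).trans (abs_apply_le_linftyNorm f x))
  exact le_mul_of_one_le_right hκ (Real.one_le_rpow hM hp.le)

theorem CapacityVolume.sobolevInfty (h : CapacityVolume p Ω κ) :
    SobolevInfty p Ω κ := by
  intro f hf
  have hM := linftyNorm_pos hf
  obtain ⟨x, hx⟩ := exists_abs_apply_eq_linftyNorm f
  have hfx : f x ≠ 0 := abs_pos.1 (hx ▸ hM)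
  have hxΩ : x ∈ Ω := by_contra fun hxΩ => hfx (f.apply_eq_zero_of_notMem hxΩ)
  set A := pEnergy p Ω f * linftyNorm Ω f ^ (-p) * vol Ω ^ ((p - n) / n) with hA
  have key (t : ℝ) (ht : t ∈ Set.Ioo (0 : ℝ) 1) : κ * t ^ p ≤ A := by
    obtain ⟨ht0, ht1⟩ := ht
    -- Dividing by the signed value f(x) gives g(x) = 1/t > 1 even where f is negative; the strict
    -- inequality leaves room for a ball.
    set g : 𝓓(Ω, ℝ) := (t * f x)⁻¹ • f with hg
    have hgx : 1 < g x := by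
      change 1 < (t * f x)⁻¹ * f x
      rw [mul_inv, mul_assoc, inv_mul_cancel₀ hfx, mul_one]
      exact (one_lt_inv₀ ht0).2 ht1
    have hU : (Ω : Set (Euc n)) ∩ {y | 1 < g y} ∈ 𝓝 x :=
      (Ω.isOpen.inter (isOpen_lt continuous_const g.continuous)).mem_nhds ⟨hxΩ, hgx⟩
    obtain ⟨r, hr, hrU⟩ := Metric.nhds_basis_closedBall.mem_iff.1 hU
    have hcap := h _ (ball_mem_AC hr (hrU.trans Set.inter_subset_left))
    have hle := pCap_le (p := p) (closure (Metric.ball x r)) (f := g) fun y hy =>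
      (hrU (Metric.closure_ball_subset_closedBall hy)).2.le
    have hκ : κ ≤ pEnergy p Ω g * vol Ω ^ ((p - n) / n) :=
      hcap.le.trans (mul_le_mul_of_nonneg_right hle (Real.rpow_nonneg vol_nonneg _))
    have htp : 0 < t ^ p := Real.rpow_pos_of_pos ht0 p
    rw [← le_div_iff₀ htp]
    refine hκ.trans_eq ?_
    rw [hg, pEnergy_smul, abs_inv, abs_mul, abs_of_pos ht0, hx, Real.inv_rpow (by positivity),
      Real.mul_rpow ht0.le hM.le, hA, Real.rpow_neg hM.le]
    field_simp
  have hlim : Tendsto (fun t : ℝ => κ * t ^ p) (𝓝[<] 1) (𝓝 κ) := by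
    have : ContinuousAt (fun t : ℝ => κ * t ^ p) 1 :=
      continuousAt_const.mul (Real.continuousAt_rpow_const _ _ (Or.inl one_ne_zero))
    simpa using this.tendsto.mono_left nhdsWithin_le_nhds
  exact le_of_tendsto hlim (Filter.mem_of_superset (Ioo_mem_nhdsLT zero_lt_one) key)

theorem setIntegral_abs_rpow_le (hp : 0 < p) (hΩ : volume (Ω : Set (Euc n)) < ⊤) (f : 𝓓(Ω, ℝ)) :
    ∫ x in (Ω : Set (Euc n)), |f x| ^ p ≤ linftyNorm Ω f ^ p * vol Ω := by
  refine (Real.le_norm_self _).trans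
    (norm_setIntegral_le_of_norm_le_const (C := linftyNorm Ω f ^ p) hΩ fun x _ => ?_)
  rw [Real.norm_of_nonneg (by positivity)]
  exact Real.rpow_le_rpow (abs_nonneg _) (abs_apply_le_linftyNorm f x) hp.le

/-- The bound ∫|f|^p ≤ ‖f‖_∞^p V(Ω) costs one factor of volume, matching p/n = (p-n)/n + 1. -/
theorem SobolevInfty.mul_setIntegral_le (hn : n ≠ 0) (hp : 0 < p) (hκ : 0 ≤ κ)
    (hΩ : volume (Ω : Set (Euc n)) < ⊤) (hV : 0 < vol Ω) (h : SobolevInfty p Ω κ) (f : 𝓓(Ω, ℝ)) :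
    κ * ∫ x in (Ω : Set (Euc n)), |f x| ^ p ≤ vol Ω ^ (p / n) * pEnergy p Ω f := by
  obtain rfl | hf := eq_or_ne f 0
  · have hz (x : Euc n) : |(0 : 𝓓(Ω, ℝ)) x| ^ p = 0 := by
      change |(0 : ℝ)| ^ p = 0
      rw [abs_zero, Real.zero_rpow hp.ne']
    simp only [hz, integral_zero, mul_zero]
    exact mul_nonneg (Real.rpow_nonneg hV.le _) (pEnergy_nonneg p _)
  have hexp : p / n = (p - n) / n + 1 := by
    have : (n : ℝ) ≠ 0 := Nat.cast_ne_zero.2 hn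
    field_simp
    ring
  calc κ * ∫ x in (Ω : Set (Euc n)), |f x| ^ p
      ≤ κ * (linftyNorm Ω f ^ p * vol Ω) :=
        mul_le_mul_of_nonneg_left (setIntegral_abs_rpow_le hp hΩ f) hκ
    _ = κ * linftyNorm Ω f ^ p * vol Ω := by ring
    _ ≤ pEnergy p Ω f * vol Ω ^ ((p - n) / n) * vol Ω :=
        mul_le_mul_of_nonneg_right (h.mul_linftyNorm_rpow_le hf) hV.le
    _ = vol Ω ^ (p / n) * pEnergy p Ω f := by
        rw [hexp, Real.rpow_add_one hV.ne']
        ring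

/-- Taking p-th roots puts the inequality in terms of norms, where the triangle inequality applies.
-/
theorem mul_eLpNorm_le_mul_eLpNorm_iff {α E F : Type*} [MeasurableSpace α] {μ : Measure α}
    [NormedAddCommGroup E] [NormedAddCommGroup F] {f : α → E} {g : α → F} (hp : 0 < p)
    (hf : MemLp f (ENNReal.ofReal p) μ) (hg : MemLp g (ENNReal.ofReal p) μ)
    {a b : ℝ} (ha : 0 ≤ a) (hb : 0 ≤ b) :
    ENNReal.ofReal (a ^ p⁻¹) * eLpNorm f (ENNReal.ofReal p) μ ≤
        ENNReal.ofReal (b ^ p⁻¹) * eLpNorm g (ENNReal.ofReal p) μ ↔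
      a * ∫ x, ‖f x‖ ^ p ∂μ ≤ b * ∫ x, ‖g x‖ ^ p ∂μ := by
  have hp0 : ENNReal.ofReal p ≠ 0 := (ENNReal.ofReal_pos.2 hp).ne'
  have hf0 : 0 ≤ ∫ x, ‖f x‖ ^ p ∂μ := integral_nonneg fun _ => by positivity
  have hg0 : 0 ≤ ∫ x, ‖g x‖ ^ p ∂μ := integral_nonneg fun _ => by positivity
  rw [hf.eLpNorm_eq_integral_rpow_norm hp0 ENNReal.ofReal_ne_top,
    hg.eLpNorm_eq_integral_rpow_norm hp0 ENNReal.ofReal_ne_top, ENNReal.toReal_ofReal hp.le,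
    ← ENNReal.ofReal_mul (by positivity), ← ENNReal.ofReal_mul (by positivity),
    ← Real.mul_rpow ha hf0, ← Real.mul_rpow hb hg0, ENNReal.ofReal_le_ofReal_iff (by positivity),
    Real.rpow_le_rpow_iff (by positivity) (by positivity) (by positivity)]

theorem MemW0.mul_setIntegral_le (hp : 1 ≤ p) {a b : ℝ} (ha : 0 ≤ a) (hb : 0 ≤ b)
    (h : ∀ f : 𝓓(Ω, ℝ), a * ∫ x in (Ω : Set (Euc n)), |f x| ^ p ≤ b * pEnergy p Ω f)
    {u : Euc n → ℝ} {g : Euc n → Euc n} (hu : MemW0 p Ω u g) :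
    a * ∫ x in (Ω : Set (Euc n)), |u x| ^ p ≤ b * ∫ x in (Ω : Set (Euc n)), ‖g x‖ ^ p := by
  have hp0 : 0 < p := zero_lt_one.trans_le hp
  have hp1 : 1 ≤ ENNReal.ofReal p := by simpa using hp
  refine (mul_eLpNorm_le_mul_eLpNorm_iff hp0 hu.memLp hu.memLp_grad ha hb).1 ?_
  obtain ⟨φ, hφ⟩ := hu.approx
  set μ := (volume : Measure (Euc n)).restrict (Ω : Set (Euc n))
  set q := ENNReal.ofReal p
  set A := ENNReal.ofReal (a ^ p⁻¹)
  set B := ENNReal.ofReal (b ^ p⁻¹)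
  set d : ℕ → ℝ≥0∞ := fun k => eLpNorm (fun x => φ k x - u x) q μ +
    eLpNorm (fun x => ∇ (φ k : Euc n → ℝ) x - g x) q μ
  -- Replacing u by φ k costs A * d k and replacing g by its gradient costs B * d k; both vanish in
  -- the limit.
  have hlim : Tendsto (fun k => B * eLpNorm g q μ + (A + B) * d k) atTop
      (𝓝 (B * eLpNorm g q μ)) := by
    have hAB : A + B ≠ ⊤ := ENNReal.add_ne_top.2 ⟨ENNReal.ofReal_ne_top, ENNReal.ofReal_ne_top⟩
    simpa using tendsto_const_nhds.add (ENNReal.Tendsto.const_mul hφ (Or.inr hAB))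
  refine ge_of_tendsto' hlim fun k => ?_
  have h1 : eLpNorm u q μ ≤ eLpNorm (φ k) q μ + d k := by
    have hsub := eLpNorm_sub_le ((φ k).memLp q).1 (((φ k).memLp q).sub hu.memLp).1 hp1
    rw [sub_sub_cancel] at hsub
    exact hsub.trans (by gcongr; exact le_self_add)
  have h2 : eLpNorm (∇ (φ k : Euc n → ℝ)) q μ ≤ eLpNorm g q μ + d k := by
    have hadd := eLpNorm_add_le hu.memLp_grad.1
      (((φ k).memLp_gradient q).sub hu.memLp_grad).1 hp1
    rw [add_sub_cancel] at hadd
    exact hadd.trans (by gcongr; exact le_add_self)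
  have h3 : A * eLpNorm (φ k) q μ ≤ B * eLpNorm (∇ (φ k : Euc n → ℝ)) q μ :=
    (mul_eLpNorm_le_mul_eLpNorm_iff hp0 ((φ k).memLp q) ((φ k).memLp_gradient q) ha hb).2 (h (φ k))
  calc A * eLpNorm u q μ ≤ A * (eLpNorm (φ k) q μ + d k) := by gcongr
    _ = A * eLpNorm (φ k) q μ + A * d k := mul_add ..
    _ ≤ B * (eLpNorm g q μ + d k) + A * d k := add_le_add_left (h3.trans (by gcongr)) _
    _ = B * eLpNorm g q μ + (A + B) * d k := by ring

theorem MemW0.setIntegral_abs_rpow_pos (hp : 0 < p) {u : Euc n → ℝ} {g : Euc n → Euc n}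
    (hu : MemW0 p Ω u g) (hu0 : ¬ u =ᵐ[volume.restrict (Ω : Set (Euc n))] 0) :
    0 < ∫ x in (Ω : Set (Euc n)), |u x| ^ p := by
  have hint : IntegrableOn (fun x => |u x| ^ p) Ω := by
    have := hu.memLp.integrable_norm_rpow (ENNReal.ofReal_pos.2 hp).ne' ENNReal.ofReal_ne_top
    rwa [ENNReal.toReal_ofReal hp.le] at this
  refine (integral_nonneg fun x => by positivity).lt_of_ne' fun h0 => hu0 ?_
  rw [integral_eq_zero_iff_of_nonneg (fun x => by positivity) hint] at h0
  filter_upwards [h0] with x hx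
  exact abs_eq_zero.1 ((Real.rpow_eq_zero (abs_nonneg _) hp.ne').1 hx)

theorem SobolevInfty.faberKrahn (hn : n ≠ 0) (hp : 1 ≤ p) (hne : (Ω : Set (Euc n)).Nonempty)
    (hΩ : volume (Ω : Set (Euc n)) < ⊤) (hV : 0 < vol Ω) (h : SobolevInfty p Ω κ) :
    FaberKrahn p Ω κ := by
  have hp0 : 0 < p := zero_lt_one.trans_le hp
  have hW : 0 < vol Ω ^ (p / n) := Real.rpow_pos_of_pos hV _
  rw [FaberKrahn, ge_iff_le, ← div_le_iff₀ hW]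
  obtain ⟨f₁, hf₁⟩ := exists_testFunction_not_ae_eq_zero hne
  refine le_csInf ⟨_, f₁, _, f₁.memW0 p, hf₁, rfl⟩ ?_
  rintro _ ⟨u, g, hu, hu0, rfl⟩
  have hpos := hu.setIntegral_abs_rpow_pos hp0 hu0
  rw [div_le_div_iff₀ hW hpos, mul_comm (∫ x in (Ω : Set (Euc n)), ‖g x‖ ^ p)]
  obtain hκ | hκ := le_total κ 0
  · exact (mul_nonpos_of_nonpos_of_nonneg hκ hpos.le).trans
      (mul_nonneg hW.le (integral_nonneg fun _ => by positivity))
  · exact hu.mul_setIntegral_le hp hκ hW.le (h.mul_setIntegral_le hn hp0 hκ hΩ hV)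

end Inequalities

theorem proposition3p4 (n : ℕ) (hn : 2 ≤ n) (p : ℝ) (hp : (n : ℝ) < p)
    (Ω : Opens (Euc n)) (hΩ : Ω ∈ AC (⊤ : Opens (Euc n))) :
    ((CapacityVolume p Ω (energyConst p Ω) ↔ SobolevInfty p Ω (energyConst p Ω)) ∧
      (CapacityVolume p Ω (energyConst p Ω) → FaberKrahn p Ω (energyConst p Ω)) ∧
      (SobolevInfty p Ω (energyConst p Ω) → FaberKrahn p Ω (energyConst p Ω))) ∧
    ∀ κ : ℝ,
      (CapacityVolume p Ω κ ↔ SobolevInfty p Ω κ) ∧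
      (CapacityVolume p Ω κ → FaberKrahn p Ω κ) ∧
      (SobolevInfty p Ω κ → FaberKrahn p Ω κ) := by
  have hp1 : 1 ≤ p := by
    have : (2 : ℝ) ≤ n := by exact_mod_cast hn
    linarith
  have hp0 : 0 < p := zero_lt_one.trans_le hp1
  have hV := vol_pos_of_mem_AC hΩ
  have hFK (κ : ℝ) (h : SobolevInfty p Ω κ) : FaberKrahn p Ω κ :=
    h.faberKrahn (by omega) hp1 hΩ.1 (volume_lt_top_of_mem_AC hΩ) hV
  have hall (κ : ℝ) : (CapacityVolume p Ω κ ↔ SobolevInfty p Ω κ) ∧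
      (CapacityVolume p Ω κ → FaberKrahn p Ω κ) ∧ (SobolevInfty p Ω κ → FaberKrahn p Ω κ) :=
    ⟨⟨fun h => h.sobolevInfty, fun h => h.capacityVolume hp0 hV⟩,
      fun h => hFK κ (h.sobolevInfty), hFK κ⟩
  exact ⟨hall _, hall⟩
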